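/- Let $(K,\delta)$ be an ordinary differential field of characteristic zero, i.e. a field of characteristic zero with a derivation $\delta:K\to K$. Call $(K,\delta)$ differentially closed (a model of $\operatorname{DCF}_0$) if every quantifier-free formula $\rho(x_1,\dots,x_t)$ with parameters from $K$, in the language $\{0,1,-,+,\cdot,\delta\}$ of differential rings, that has a realization in some differential field extension of $(K,\delta)$ has a realization in $K$. For $X\subseteq K^n$, let the (first) prolongation $\tau_\delta X\subseteq K^{2n}$ be the set of all $(x,y)\in K^n\times K^n$ with $x\in X$ and $$\sum_{i=1}^n\frac{\partial f}{\partial x_i}(x)\,y_i+f^\delta(x)=0$$ for every polynomial $f\in K[x_1,\dots,x_n]$ vanishing on $X$ (equivalently, for each $f$ in a fixed generating set of the ideal of such polynomials), where $f^\delta$ is obtained from $f$ by applying $\delta$ to its coefficients. Let $\pi:K^{2n}\to K^n$ be the projection onto the first $n$ coordinates. **Proposition.** $(K,\delta)$ is differentially closed if and only if $K$ is algebraically closed and the following condition holds: ($\dagger$) for every $n$ and every irreducible Zariski-closed set $W\subseteq K^{2n}$ with $W\subseteq\tau_\delta(\pi(W))$, there is $a=(a_1,\dots,a_n)\in K^n$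 with $(a,\delta a)\in W$, where $\delta a=(\delta a_1,\dots,\delta a_n)$. (An irreducible set is by convention non-empty.) -/

import Mathlib

namespace DiffClosed

universe u

open scoped Differential

noncomputable section

/-! ### The language of (ordinary) differential rings and existential closedness -/

/-- The function symbols of the language of differential rings: those of rings, and a unary
symbol for the derivation. -/
inductive DiffRingFunc : ℕ → Type
  | zero : DiffRingFunc 0
  | one : DiffRingFunc 0
  | neg : DiffRingFunc 1
  | add : DiffRingFunc 2
  | mul : DiffRingFunc 2
  | deriv : DiffRingFunc 1

/-- The language `{0, 1, -, +, ·, δ}` of ordinary differential rings. -/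
def diffRingLanguage : FirstOrder.Language.{0, 0} where
  Functions := DiffRingFunc
  Relations := fun _ => Empty

/-- A differential ring as a structure in the language of differential rings. -/
instance diffRingStructure (R : Type*) [CommRing R] [Differential R] :
    diffRingLanguage.Structure R where
  RelMap := fun {_} (r : Empty) _ => r.elim
  funMap := fun {n} (f : DiffRingFunc n) =>
    match f with
    | .zero => fun _ => 0
    | .one => fun _ => 1
    | .neg => fun x => -x 0
    | .add => fun x => x 0 + x 1
    | .mul => fun x => x 0 * x 1
    | .deriv => fun x => (x 0)′

/-- A differential field `K` is differentially closed if it is existentially closed: every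
quantifier-free formula over `K` (in finitely many variables, in the language of differential
rings) that has a realization in some differential field extension of `K` has one in `K`.

A formula over `K` in the variables `x₁, …, xₜ` is a formula whose free variables are indexed by
`K ⊕ Fin t`, where the variables indexed by `K` are interpreted as the corresponding parameters. -/
def IsDifferentiallyClosed (K : Type u) [Field K] [Differential K] : Prop :=
  ∀ (F : Type u) [Field F] [Differential F] [Algebra K F] [DifferentialAlgebra K F]
    (t : ℕ) (ρ : diffRingLanguage.Formula (K ⊕ Fin t)), ρ.IsQF →
    (∃ c : Fin t → F, ρ.Realize (Sum.elim (algebraMap K F) c)) →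
    ∃ a : Fin t → K, ρ.Realize (Sum.elim (fun k : K => k) a)

/-! ### Affine algebraic sets -/

/-- Zariski-closed subsets of the affine space with coordinates indexed by `σ`. -/
def IsZariskiClosed {σ : Type*} {K : Type*} [Field K] (W : Set (σ → K)) : Prop :=
  ∃ I : Ideal (MvPolynomial σ K), W = MvPolynomial.zeroLocus K I

/-- `W` is non-empty, and it is not covered by two Zariski-closed sets neither of which
contains it. -/
def IsZariskiIrreducible {σ : Type*} {K : Type*} [Field K] (W : Set (σ → K)) : Prop :=
  W.Nonempty ∧ ∀ A B : Set (σ → K), IsZariskiClosed A → IsZariskiClosed B →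
    W ⊆ A ∪ B → W ⊆ A ∨ W ⊆ B

/-! ### Prolongations

The space `K²ⁿ` is `Fin n ⊕ Fin n → K`; the left summand holds the first `n` coordinates. -/

/-- The projection `π : K²ⁿ → Kⁿ` onto the first `n` coordinates. -/
def proj {n : ℕ} {K : Type*} (w : Fin n ⊕ Fin n → K) : Fin n → K :=
  fun i => w (Sum.inl i)

/-- The polynomial `f^δ`, obtained by applying the derivation to the coefficients of `f`. -/
def coeffDeriv {σ : Type*} {K : Type*} [Field K] [Differential K] (f : MvPolynomial σ K) :
    MvPolynomial σ K :=
  ∑ m ∈ f.support, MvPolynomial.monomial m (f.coeff m)′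

/-- The (first) prolongation `τ_δ X ⊆ K²ⁿ` of `X ⊆ Kⁿ`: the points `(x, y)` with `x ∈ X` and
`∑ i, (∂f/∂xᵢ)(x) yᵢ + f^δ(x) = 0` for every polynomial `f` over `K` that vanishes on `X`. Since
`x ∈ X`, it is the same to ask this of a set of generators of that ideal only. -/
def prolongation {n : ℕ} {K : Type*} [Field K] [Differential K] (X : Set (Fin n → K)) :
    Set (Fin n ⊕ Fin n → K) :=
  {w | proj w ∈ X ∧ ∀ f ∈ MvPolynomial.vanishingIdeal K X,
    ∑ i : Fin n, MvPolynomial.eval (proj w) (MvPolynomial.pderiv i f) * w (Sum.inr i)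
      + MvPolynomial.eval (proj w) (coeffDeriv f) = 0}

/-- Condition (†): for every `n`, every irreducible Zariski-closed `W ⊆ K²ⁿ` with
`W ⊆ τ_δ(π(W))` has a point of the form `(a, δa)`. -/
def PiercePillay (K : Type*) [Field K] [Differential K] : Prop :=
  ∀ (n : ℕ) (W : Set (Fin n ⊕ Fin n → K)), IsZariskiClosed W → IsZariskiIrreducible W →
    W ⊆ prolongation (proj '' W) →
    ∃ a : Fin n → K, Sum.elim a (fun i => (a i)′) ∈ W

end

end DiffClosed

/-! In characteristic zero, the equations of the prolongation are the only obstruction to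
prescribing a derivation: if `totalDeriv x y` kills every polynomial relation of `x` over `K`, some
derivation of `F` extends that of `K` and sends `x` to `y` (`exists_differential`). Indeed
derivations are sections of the projection from the dual numbers, and these extend along formally
smooth maps.

Forward: with no variables, this extends the derivation to the algebraic closure, where polynomials
have roots. For (†), take the generic point `(x, y)` of `W` in its function field; `W ⊆ τ(π(W))` is
what allows `x′ = y`, and existential closedness brings the finitely many equations of `W` down to
`K`.

Backward: the truth of a quantifier-free formula at a point of `F` depends on finitely many elements
of `F`. List them as `x`. The locus of `(x, x′)` over `K` is irreducible and lies in the
prolongation of its projection, as differentiating the relations of `x` shows. A point `(a, a′)` on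
it gives a specialization `x ↦ a` that preserves the formula (`PiercePillay.exists_specialization`,
`exists_finite_realize_iff`). -/

namespace DiffClosed

universe u

open scoped Differential
open MvPolynomial FirstOrder

/-! ### Differentiating the value of a polynomial. -/

section CoeffDeriv

variable {σ : Type*} {K : Type*} [Field K] [Differential K]

lemma coeff_coeffDeriv (f : MvPolynomial σ K) (m : σ →₀ ℕ) :
    (coeffDeriv f).coeff m = (f.coeff m)′ := by
  classical
  unfold coeffDeriv
  rw [coeff_sum]
  simp only [coeff_monomial]
  rw [Finset.sum_ite_eq']
  split_ifs with h
  · rfl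
  · rw [notMem_support_iff.1 h, map_zero]

lemma coeffDeriv_add (f g : MvPolynomial σ K) :
    coeffDeriv (f + g) = coeffDeriv f + coeffDeriv g := by
  ext m
  simp [coeff_coeffDeriv]

lemma coeffDeriv_C (a : K) : coeffDeriv (C a : MvPolynomial σ K) = C a′ := by
  classical
  ext m
  rw [coeff_coeffDeriv, coeff_C, coeff_C]
  split_ifs <;> simp

lemma coeffDeriv_mul_X (f : MvPolynomial σ K) (i : σ) :
    coeffDeriv (f * X i) = coeffDeriv f * X i := by
  classical
  ext m
  rw [coeff_coeffDeriv, coeff_mul_X', coeff_mul_X', coeff_coeffDeriv]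
  split_ifs <;> simp

/-- The polynomial `∑ i, (∂f/∂xᵢ) yᵢ + f^δ`, evaluated at a point of a `K`-algebra. -/
noncomputable def totalDeriv [Fintype σ] {R : Type*} [CommRing R] [Algebra K R]
    (x y : σ → R) (f : MvPolynomial σ K) : R :=
  ∑ i, aeval x (pderiv i f) * y i + aeval x (coeffDeriv f)

variable [Fintype σ] {R : Type*} [CommRing R] [Algebra K R] (x y : σ → R)

lemma totalDeriv_C (a : K) : totalDeriv x y (C a : MvPolynomial σ K) = algebraMap K R a′ := by
  simp [totalDeriv, coeffDeriv_C]

lemma totalDeriv_add (f g : MvPolynomial σ K) :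
    totalDeriv x y (f + g) = totalDeriv x y f + totalDeriv x y g := by
  simp only [totalDeriv, coeffDeriv_add, map_add, add_mul, Finset.sum_add_distrib]
  ring

lemma totalDeriv_mul_X (f : MvPolynomial σ K) (i : σ) :
    totalDeriv x y (f * X i) = totalDeriv x y f * x i + aeval x f * y i := by
  classical
  have h : ∀ j, aeval x (pderiv j (f * X i)) * y j
      = aeval x (pderiv j f) * y j * x i + if j = i then aeval x f * y j else 0 := by
    intro j
    by_cases hj : j = i
    · subst hj
      simp [Derivation.leibniz]
      ring
    · simp [Derivation.leibniz, pderiv_X_of_ne (Ne.symm hj), hj]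
      ring
  simp only [totalDeriv, coeffDeriv_mul_X, h, Finset.sum_add_distrib, ← Finset.sum_mul,
    Finset.sum_ite_eq', Finset.mem_univ, if_true, map_mul, aeval_X]
  ring

lemma deriv_aeval [Differential R] [DifferentialAlgebra K R] (f : MvPolynomial σ K) :
    (aeval x f)′ = totalDeriv x (fun i => (x i)′) f := by
  induction f using MvPolynomial.induction_on with
  | C a => rw [totalDeriv_C, aeval_C, deriv_algebraMap]
  | add p q hp hq => rw [map_add, map_add, hp, hq, totalDeriv_add]
  | mul_X p i hp =>
    rw [totalDeriv_mul_X, map_mul, aeval_X, Derivation.leibniz, hp]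
    simp only [smul_eq_mul]
    ring

open TrivSqZeroExt in
/-- The homomorphism to the dual numbers given by evaluation and by `totalDeriv`. -/
lemma exists_ringHom_dualNumber :
    ∃ ψ : MvPolynomial σ K →+* DualNumber R,
      ∀ f, (ψ f).fst = aeval x f ∧ (ψ f).snd = totalDeriv x y f := by
  let θ : K →+* DualNumber R :=
    { toFun := fun k => inl (algebraMap K R k) + inr (algebraMap K R k′)
      map_one' := by ext <;> simp
      map_zero' := by ext <;> simp
      map_add' := fun a b => by ext <;> simp [-DualNumber.inr_eq_smul_eps]
      map_mul' := fun a b => by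
        ext <;> simp [Derivation.leibniz, -DualNumber.inr_eq_smul_eps]
        ring }
  refine ⟨eval₂Hom θ fun i => inl (x i) + inr (y i), fun f => ?_⟩
  induction f using MvPolynomial.induction_on with
  | C a => simp [θ, totalDeriv_C, -DualNumber.inr_eq_smul_eps]
  | add p q hp hq =>
    rw [map_add, totalDeriv_add, fst_add, snd_add, hp.1, hp.2, hq.1, hq.2, map_add]
    exact ⟨rfl, rfl⟩
  | mul_X p i hp =>
    rw [map_mul, totalDeriv_mul_X, fst_mul, snd_mul, hp.1, hp.2, map_mul]
    simp
    ring

end CoeffDeriv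

/-! ### Extending derivations through dual numbers. -/

section Extension

open TrivSqZeroExt

/-- Above a transcendence basis the extension is algebraic, hence separable in characteristic zero.
-/
lemma formallySmooth_of_charZero (L F : Type*) [Field L] [Field F] [Algebra L F] [CharZero L] :
    Algebra.FormallySmooth L F := by
  obtain ⟨s, v, hs⟩ := exists_isTranscendenceBasis' L F
  have := hs.isAlgebraic_field
  exact .of_algebraicIndependent_of_isSeparable hs.1

/-- A homomorphism from a domain to the dual numbers of a field of characteristic zero
containing it, lifting the inclusion, extends to the field. -/
lemma exists_lift_dualNumber {A F : Type*} [CommRing A] [IsDomain A] [Field F] [CharZero F]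
    [Algebra A F] [FaithfulSMul A F] (ψ : A →+* DualNumber F)
    (hψ : ∀ a, (ψ a).fst = algebraMap A F a) :
    ∃ φ : F →+* DualNumber F, (∀ z, (φ z).fst = z) ∧ ∀ a, φ (algebraMap A F a) = ψ a := by
  let : Algebra (FractionRing A) F := FractionRing.liftAlgebra A F
  have : IsScalarTower A (FractionRing A) F := FractionRing.isScalarTower_liftAlgebra A F
  have : CharZero (FractionRing A) :=
    (RingHom.charZero_iff (algebraMap (FractionRing A) F).injective).2 inferInstance
  have := formallySmooth_of_charZero (FractionRing A) F
  have : Algebra.FormallySmooth A (FractionRing A) :=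
    .of_isLocalization (nonZeroDivisors A)
  have : Algebra.FormallySmooth A F := .comp A (FractionRing A) F
  -- For this algebra structure, an `A`-linear section of `p` is exactly an extension of `ψ`; it
  -- exists because the kernel of `p` squares to zero.
  let : Algebra A (DualNumber F) := ψ.toAlgebra
  let p : DualNumber F →ₐ[A] F :=
    { (fstHom F F F : DualNumber F →ₐ[F] F).toRingHom with
      commutes' := fun a => hψ a }
  have hp : Function.Surjective p := fun z => ⟨inl z, rfl⟩
  have hk : IsNilpotent (RingHom.ker (p : DualNumber F →+* F)) := by
    refine ⟨2, (sq (RingHom.ker (p : DualNumber F →+* F))).trans (le_bot_iff.1 ?_)⟩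
    rw [Ideal.mul_le]
    intro r hr s hs
    have hr' : r.fst = 0 := hr
    have hs' : s.fst = 0 := hs
    rw [Ideal.mem_bot]
    ext <;> simp [hr', hs']
  let φ := Algebra.FormallySmooth.liftOfSurjective (AlgHom.id A F) p hp hk
  refine ⟨φ, fun z => ?_, fun a => φ.commutes a⟩
  exact Algebra.FormallySmooth.liftOfSurjective_apply (AlgHom.id A F) p hp hk z

/-- A derivation defined by a section of the projection from the dual numbers. -/
@[reducible]
def differentialOfSection {F : Type*} [Field F] (φ : F →+* DualNumber F)
    (hφ : ∀ z, (φ z).fst = z) : Differential F where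
  deriv := Derivation.mk'
    ({ toFun := fun z => (φ z).snd
       map_zero' := by simp
       map_add' := by simp } : F →+ F).toIntLinearMap (fun a b => by
        simp [hφ, mul_comm])

/-- A point `(x, y)` satisfying the equations of the prolongation of the locus of `x` comes from
a derivation. -/
lemma exists_differential {K F : Type*} [Field K] [Differential K] [Field F] [CharZero F]
    [Algebra K F] {σ : Type*} [Fintype σ] (x y : σ → F)
    (h : ∀ f : MvPolynomial σ K, aeval x f = 0 → totalDeriv x y f = 0) :
    ∃ _ : Differential F, DifferentialAlgebra K F ∧ ∀ i, (x i)′ = y i := by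
  obtain ⟨ψ, hψ⟩ := exists_ringHom_dualNumber (K := K) x y
  let e : MvPolynomial σ K →+* F := (aeval x : MvPolynomial σ K →ₐ[K] F).toRingHom
  let : Algebra (MvPolynomial σ K ⧸ RingHom.ker e) F := e.kerLift.toAlgebra
  have : FaithfulSMul (MvPolynomial σ K ⧸ RingHom.ker e) F :=
    (faithfulSMul_iff_algebraMap_injective _ _).2 e.kerLift_injective
  have : (RingHom.ker e).IsPrime := RingHom.ker_isPrime e
  -- The hypothesis `h` is what lets `ψ` descend to the subring `K[x]` of `F`.
  let ψ' : MvPolynomial σ K ⧸ RingHom.ker e →+* DualNumber F :=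
    Ideal.Quotient.lift _ ψ fun f hf => by
      ext
      · exact (hψ f).1.trans hf
      · exact (hψ f).2.trans (h f hf)
  obtain ⟨φ, hφ, hφψ⟩ := exists_lift_dualNumber ψ' (fun a => by
    obtain ⟨f, rfl⟩ := Ideal.Quotient.mk_surjective a
    exact (hψ f).1)
  have key : ∀ f : MvPolynomial σ K, (φ (aeval x f)).snd = totalDeriv x y f := fun f =>
    (congrArg snd (hφψ (Ideal.Quotient.mk _ f))).trans (hψ f).2
  refine ⟨differentialOfSection φ hφ, @DifferentialAlgebra.mk _ _ _ _ _ _ (_) fun a => ?_,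
    fun i => ?_⟩
  · have := key (C a)
    rwa [totalDeriv_C, aeval_C] at this
  · have := key (1 * X i)
    rw [totalDeriv_mul_X, one_mul, aeval_X, ← C_1, totalDeriv_C, C_1] at this
    simp only [Derivation.map_one_eq_zero, map_zero, zero_mul, zero_add, map_one, one_mul] at this
    exact this

end Extension

/-! ### First-order systems of differential equations as formulas. -/

section Formulas

/-- The function symbol of addition. -/
def addFunc : diffRingLanguage.Functions 2 := DiffRingFunc.add

/-- The function symbol of multiplication. -/
def mulFunc : diffRingLanguage.Functions 2 := DiffRingFunc.mul

/-- The function symbol of the derivation. -/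
def derivFunc : diffRingLanguage.Functions 1 := DiffRingFunc.deriv

/-- Differential polynomials of order at most one are given by terms. -/
lemma exists_term_realize_eq_aeval {K : Type u} [Field K] {t : ℕ}
    (f : MvPolynomial (Fin t ⊕ Fin t) K) :
    ∃ T : diffRingLanguage.Term (K ⊕ Fin t), ∀ (R : Type u) [CommRing R] [Differential R]
      [Algebra K R] (c : Fin t → R),
      T.realize (Sum.elim (algebraMap K R) c) = aeval (Sum.elim c fun i => (c i)′) f := by
  have hmul : ∀ p q : MvPolynomial (Fin t ⊕ Fin t) K,
      ∀ T T' : diffRingLanguage.Term (K ⊕ Fin t),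
      (∀ (R : Type u) [CommRing R] [Differential R] [Algebra K R] (c : Fin t → R),
        T.realize (Sum.elim (algebraMap K R) c) = aeval (Sum.elim c fun i => (c i)′) p) →
      (∀ (R : Type u) [CommRing R] [Differential R] [Algebra K R] (c : Fin t → R),
        T'.realize (Sum.elim (algebraMap K R) c) = aeval (Sum.elim c fun i => (c i)′) q) →
      ∀ (R : Type u) [CommRing R] [Differential R] [Algebra K R] (c : Fin t → R),
        (Language.Functions.apply₂ mulFunc T T').realize
          (Sum.elim (algebraMap K R) c) = aeval (Sum.elim c fun i => (c i)′) (p * q) := by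
    intro p q T T' h h' R _ _ _ c
    rw [map_mul, ← h, ← h', Language.Term.realize_functions_apply₂]
    rfl
  induction f using MvPolynomial.induction_on with
  | C a =>
    refine ⟨Language.var (Sum.inl a), fun R _ _ _ c => ?_⟩
    simp
  | add p q hp hq =>
    obtain ⟨T, hT⟩ := hp
    obtain ⟨T', hT'⟩ := hq
    refine ⟨Language.Functions.apply₂ addFunc T T',
      fun R _ _ _ c => ?_⟩
    rw [map_add, ← hT, ← hT', Language.Term.realize_functions_apply₂]
    rfl
  | mul_X p i hp =>
    obtain ⟨T, hT⟩ := hp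
    rcases i with i | i
    · exact ⟨_, hmul _ _ T (Language.var (Sum.inr i)) hT fun R _ _ _ c => by simp⟩
    · refine ⟨_, hmul _ _ T (Language.Functions.apply₁
        derivFunc (Language.var (Sum.inr i))) hT
        fun R _ _ _ c => ?_⟩
      rw [Language.Term.realize_functions_apply₁, aeval_X]
      rfl

/-- Finite systems of differential equations of order at most one are given by quantifier-free
formulas. -/
lemma exists_isQF_realize_iff {K : Type u} [Field K] {t : ℕ}
    (s : Finset (MvPolynomial (Fin t ⊕ Fin t) K)) :
    ∃ ρ : diffRingLanguage.Formula (K ⊕ Fin t), ρ.IsQF ∧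
      ∀ (R : Type u) [CommRing R] [Differential R] [Algebra K R] (c : Fin t → R),
      ρ.Realize (Sum.elim (algebraMap K R) c) ↔
        ∀ f ∈ s, aeval (Sum.elim c fun i => (c i)′) f = 0 := by
  classical
  induction s using Finset.induction_on with
  | empty =>
    refine ⟨⊤, .top, fun R _ _ _ c => ?_⟩
    simp [Language.Formula.Realize]
  | insert f s _ ih =>
    obtain ⟨ρ, hρ, h⟩ := ih
    obtain ⟨T, hT⟩ := exists_term_realize_eq_aeval f
    obtain ⟨Z, hZ⟩ := exists_term_realize_eq_aeval (0 : MvPolynomial (Fin t ⊕ Fin t) K)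
    refine ⟨T.equal Z ⊓ ρ, .inf (.of_isAtomic (.equal _ _)) hρ, fun R _ _ _ c => ?_⟩
    have h1 := h R c
    have h2 : (T.equal Z).Realize (Sum.elim (algebraMap K R) c) ↔
        aeval (Sum.elim c fun i => (c i)′) f = 0 := by
      rw [Language.Formula.realize_equal, hT, hZ, map_zero]
    rw [Finset.forall_mem_insert, ← h1, ← h2]
    exact Language.BoundedFormula.realize_inf

lemma IsDifferentiallyClosed.exists_zero {K : Type u} [Field K] [Differential K]
    (hK : IsDifferentiallyClosed K) {F : Type u} [Field F] [Differential F] [Algebra K F]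
    [DifferentialAlgebra K F] {t : ℕ} (s : Finset (MvPolynomial (Fin t ⊕ Fin t) K))
    (c : Fin t → F) (hc : ∀ f ∈ s, aeval (Sum.elim c fun i => (c i)′) f = 0) :
    ∃ a : Fin t → K, ∀ f ∈ s, aeval (Sum.elim a fun i => (a i)′) f = 0 := by
  obtain ⟨ρ, hρ, h⟩ := exists_isQF_realize_iff s
  obtain ⟨a, ha⟩ := hK F t ρ hρ ⟨c, (h F c).2 hc⟩
  exact ⟨a, (h K a).1 ha⟩

end Formulas

/-! ### Differentially closed fields are algebraically closed and satisfy (†). -/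

section Forward

variable {K : Type u} [Field K] [CharZero K] [Differential K]

theorem IsDifferentiallyClosed.isAlgClosed (hK : IsDifferentiallyClosed K) : IsAlgClosed K := by
  refine .of_exists_root K fun p _ hp => ?_
  have : CharZero (AlgebraicClosure K) := algebraRat.charZero _
  -- Without variables the only relation is `0 = 0`.
  obtain ⟨D, hD, -⟩ := exists_differential (K := K) (F := AlgebraicClosure K)
    (σ := Empty) Empty.elim Empty.elim (fun f hf => by
      obtain ⟨a, rfl⟩ := C_surjective Empty f
      rw [aeval_C, map_eq_zero] at hf
      rw [totalDeriv_C, hf, map_zero, map_zero])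
  obtain ⟨z, hz⟩ := IsAlgClosed.exists_aeval_eq_zero (AlgebraicClosure K) p
    (Polynomial.degree_pos_of_irreducible hp).ne'
  have h : ∀ (R : Type u) [CommRing R] [Algebra K R] (w : Fin 1 ⊕ Fin 1 → R),
      aeval w (Polynomial.aeval (X (Sum.inl 0) : MvPolynomial (Fin 1 ⊕ Fin 1) K) p)
        = Polynomial.aeval (w (Sum.inl 0)) p := by
    intro R _ _ w
    rw [← Polynomial.aeval_algHom_apply, aeval_X]
  obtain ⟨a, ha⟩ := hK.exists_zero (F := AlgebraicClosure K)
    {Polynomial.aeval (X (Sum.inl 0) : MvPolynomial (Fin 1 ⊕ Fin 1) K) p} (fun _ => z)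
    (by simpa [h] using hz)
  refine ⟨a 0, ?_⟩
  have := ha _ (Finset.mem_singleton_self _)
  rwa [h, Polynomial.coe_aeval_eq_eval] at this

lemma aeval_rename_inl {n : ℕ} {K : Type*} [Field K] (w : Fin n ⊕ Fin n → K)
    (f : MvPolynomial (Fin n) K) : aeval w (rename Sum.inl f) = eval (proj w) f := by
  rw [aeval_rename]
  rfl

lemma IsZariskiIrreducible.isPrime_vanishingIdeal {σ K : Type*} [Field K] {W : Set (σ → K)}
    (hW : IsZariskiIrreducible W) : (vanishingIdeal K W).IsPrime := by
  obtain ⟨⟨w, hw⟩, hirr⟩ := hW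
  refine ⟨fun h => ?_, fun {f g} hfg => ?_⟩
  · have : (1 : MvPolynomial σ K) ∈ vanishingIdeal K W := h ▸ Submodule.mem_top
    simpa using this w hw
  · have key : ∀ f : MvPolynomial σ K, W ⊆ zeroLocus K (Ideal.span {f}) →
        f ∈ vanishingIdeal K W := fun f hf x hx => hf hx f (Ideal.mem_span_singleton_self f)
    refine (hirr _ _ ⟨Ideal.span {f}, rfl⟩ ⟨Ideal.span {g}, rfl⟩ fun x hx => ?_).imp
      (key f) (key g)
    have := hfg x hx
    rw [map_mul, mul_eq_zero] at this
    simpa [zeroLocus_span] using this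

lemma IsZariskiClosed.zeroLocus_vanishingIdeal {σ K : Type*} [Field K] {W : Set (σ → K)}
    (hW : IsZariskiClosed W) : zeroLocus K (vanishingIdeal K W) = W := by
  obtain ⟨I, rfl⟩ := hW
  exact zeroLocus_vanishingIdeal_galoisConnection.l_u_l_eq_l I

theorem IsDifferentiallyClosed.piercePillay (hK : IsDifferentiallyClosed K) : PiercePillay K := by
  intro n W hcl hirr hW
  have := hirr.isPrime_vanishingIdeal
  let I := vanishingIdeal K W
  -- The function field of `W`, with generic point `z`.
  let F := FractionRing (MvPolynomial (Fin n ⊕ Fin n) K ⧸ I)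
  have : CharZero F := (RingHom.charZero_iff (algebraMap K F).injective).1 inferInstance
  let z : Fin n ⊕ Fin n → F := fun j => algebraMap _ F (Ideal.Quotient.mk I (X j))
  have hz : ∀ f, aeval z f = algebraMap (MvPolynomial (Fin n ⊕ Fin n) K ⧸ I) F
      (Ideal.Quotient.mk I f) := by
    have : aeval z = ((IsScalarTower.toAlgHom K (MvPolynomial (Fin n ⊕ Fin n) K ⧸ I) F).comp
        (Ideal.Quotient.mkₐ K I)) := by
      ext j
      simp [z]
    intro f
    rw [this]
    rfl
  have hz0 : ∀ f, aeval z f = 0 ↔ f ∈ I := fun f => by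
    rw [hz, map_eq_zero_iff _ (IsFractionRing.injective _ F), Ideal.Quotient.eq_zero_iff_mem]
  have hren : ∀ f : MvPolynomial (Fin n) K,
      aeval (fun i => z (Sum.inl i)) f = aeval z (rename Sum.inl f) := fun f => by
    rw [aeval_rename]; rfl
  obtain ⟨D, hD, hxy⟩ := exists_differential (K := K) (fun i => z (Sum.inl i))
    (fun i => z (Sum.inr i)) (fun f hf => by
      rw [hren, hz0] at hf
      have hf' : f ∈ vanishingIdeal K (proj '' W) := by
        rintro _ ⟨w, hw, rfl⟩
        have := hf w hw
        rwa [aeval_rename] at this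
      -- The prolongation equation of `f` holds on all of `W`, hence at the generic point.
      have hmem : ∑ i, rename Sum.inl (pderiv i f) * X (Sum.inr i)
          + rename Sum.inl (coeffDeriv f) ∈ I := by
        intro w hw
        simp only [map_add, map_sum, map_mul, aeval_X, aeval_rename_inl]
        exact (hW hw).2 f hf'
      rw [← hz0] at hmem
      simpa [totalDeriv, hren] using hmem)
  obtain ⟨s, hs⟩ := (inferInstance : IsNoetherianRing (MvPolynomial (Fin n ⊕ Fin n) K)).noetherian I
  have hzz : (Sum.elim (fun i => z (Sum.inl i)) fun i => (z (Sum.inl i))′) = z := by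
    ext (i | i)
    · rfl
    · exact hxy i
  obtain ⟨a, ha⟩ := hK.exists_zero s (fun i => z (Sum.inl i)) (fun f hf => by
    rw [hzz, hz0, ← hs]
    exact Submodule.subset_span hf)
  refine ⟨a, ?_⟩
  rw [← hcl.zeroLocus_vanishingIdeal]
  change _ ∈ zeroLocus K I
  rw [← hs]
  change _ ∈ zeroLocus K (Ideal.span _)
  rw [zeroLocus_span]
  exact ha

end Forward

/-! ### From (†) to existential closedness. -/

section Backward

/-- By the Nullstellensatz a prime ideal is the vanishing ideal of its zero locus. -/
lemma isZariskiIrreducible_zeroLocus {σ K : Type*} [Finite σ] [Field K] [IsAlgClosed K]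
    (I : Ideal (MvPolynomial σ K)) [hI : I.IsPrime] :
    IsZariskiIrreducible (zeroLocus K I) := by
  refine ⟨?_, ?_⟩
  · by_contra h
    rw [Set.not_nonempty_iff_eq_empty] at h
    have := IsPrime.vanishingIdeal_zeroLocus (K := K) I
    rw [h, vanishingIdeal_empty] at this
    exact hI.ne_top this.symm
  · rintro _ _ ⟨I₁, rfl⟩ ⟨I₂, rfl⟩ h
    have : I₁ * I₂ ≤ I := by
      rw [← IsPrime.vanishingIdeal_zeroLocus (K := K) I, Ideal.mul_le]
      intro f hf g hg x hx
      rw [map_mul, mul_eq_zero]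
      exact (h hx).imp (fun h => h f hf) (fun h => h g hg)
    exact (hI.mul_le.1 this).imp (fun h => zeroLocus_anti_mono h) fun h => zeroLocus_anti_mono h

variable {K : Type*} [Field K] [Differential K] {F : Type*} [Field F] [Differential F]
  [Algebra K F]

/-- Under condition (†), every finite tuple in a differential field extension specializes to a
tuple of `K`, preserving differential polynomial equations of order at most one. -/
lemma PiercePillay.exists_specialization [DifferentialAlgebra K F] [IsAlgClosed K] (hK : PiercePillay K) {n : ℕ}
    (x : Fin n → F) :
    ∃ a : Fin n → K, ∀ f : MvPolynomial (Fin n ⊕ Fin n) K,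
      aeval (Sum.elim x fun i => (x i)′) f = 0 → aeval (Sum.elim a fun i => (a i)′) f = 0 := by
  set z : Fin n ⊕ Fin n → F := Sum.elim x (fun i => (x i)′)
  let I : Ideal (MvPolynomial (Fin n ⊕ Fin n) K) := RingHom.ker (aeval z).toRingHom
  have hI : ∀ f, f ∈ I ↔ aeval z f = 0 := fun f => RingHom.mem_ker
  have : I.IsPrime := RingHom.ker_isPrime _
  have hxz : ∀ f : MvPolynomial (Fin n) K, aeval z (rename Sum.inl f) = aeval x f := fun f => by
    rw [aeval_rename]; rfl
  obtain ⟨a, ha⟩ := hK n (zeroLocus K I) ⟨I, rfl⟩ (isZariskiIrreducible_zeroLocus I) (by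
    intro w hw
    refine ⟨⟨w, hw, rfl⟩, fun f hf => ?_⟩
    -- By the Nullstellensatz, vanishing on the projection of the locus amounts to being a relation
    -- of `x`; that relation is then differentiated.
    have hfI : rename Sum.inl f ∈ I := by
      rw [← IsPrime.vanishingIdeal_zeroLocus (K := K) I]
      intro v hv
      rw [aeval_rename]
      exact hf _ ⟨v, hv, rfl⟩
    rw [hI, hxz] at hfI
    have hmem : ∑ i, rename Sum.inl (pderiv i f) * X (Sum.inr i)
        + rename Sum.inl (coeffDeriv f) ∈ I := by
      have h := deriv_aeval x f
      rw [hfI, map_zero] at h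
      rw [hI, h]
      simp only [totalDeriv, map_add, map_sum, map_mul, hxz, aeval_X]
      rfl
    have := hw _ hmem
    simp only [map_add, map_sum, map_mul, aeval_X, aeval_rename_inl] at this
    exact this)
  exact ⟨a, fun f hf => ha f ((hI f).2 hf)⟩

/-- `g` fixes `K` and respects the differential ring operations on elements of `S`. -/
structure IsSpecializationOn (S : Set F) (g : F → K) : Prop where
  algebraMap : ∀ k, g (algebraMap K F k) = k
  add : ∀ u ∈ S, ∀ v ∈ S, g (u + v) = g u + g v
  mul : ∀ u ∈ S, ∀ v ∈ S, g (u * v) = g u * g v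
  neg : ∀ u ∈ S, g (-u) = -g u
  deriv : ∀ u ∈ S, g u′ = (g u)′

lemma IsSpecializationOn.mono {S T : Set F} {g : F → K} (hg : IsSpecializationOn T g)
    (h : S ⊆ T) : IsSpecializationOn S g :=
  ⟨hg.algebraMap, fun u hu v hv => hg.add u (h hu) v (h hv),
    fun u hu v hv => hg.mul u (h hu) v (h hv), fun u hu => hg.neg u (h hu),
    fun u hu => hg.deriv u (h hu)⟩

/-- With `S` listed as `x`, the operations on `S` stay inside `K[x, x′]`, where specialization is a
ring homomorphism. The value of `g` elsewhere is immaterial. -/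
lemma PiercePillay.exists_isSpecializationOn [DifferentialAlgebra K F] [IsAlgClosed K]
    (hK : PiercePillay K) {S : Set F} (hS : S.Finite) : ∃ g : F → K, IsSpecializationOn S g := by
  classical
  obtain ⟨n, x, -, rfl⟩ := hS.fin_param
  obtain ⟨a, ha⟩ := hK.exists_specialization x
  set z : Fin n ⊕ Fin n → F := Sum.elim x (fun i => (x i)′)
  set w : Fin n ⊕ Fin n → K := Sum.elim a (fun i => (a i)′)
  -- The chosen preimage does not matter: two preimages differ by a relation of `z`, which `w` also
  -- satisfies.
  let e : Set.range (aeval z : MvPolynomial (Fin n ⊕ Fin n) K →ₐ[K] F) → K :=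
    fun u => aeval w u.2.choose
  let g : F → K := fun u =>
    if h : u ∈ Set.range (aeval z : MvPolynomial (Fin n ⊕ Fin n) K →ₐ[K] F) then e ⟨u, h⟩ else 0
  have hg : ∀ f : MvPolynomial (Fin n ⊕ Fin n) K, g (aeval z f) = aeval w f := by
    intro f
    have h : aeval z f ∈ Set.range (aeval z : MvPolynomial (Fin n ⊕ Fin n) K →ₐ[K] F) := ⟨f, rfl⟩
    have h' := ha (h.choose - f) (by rw [map_sub, h.choose_spec, sub_self])
    rw [map_sub, sub_eq_zero] at h'
    exact (dif_pos h).trans h'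
  have hx : ∀ i, x i = aeval z (X (Sum.inl i) : MvPolynomial (Fin n ⊕ Fin n) K) := fun i => by
    rw [aeval_X]; rfl
  have hx' : ∀ i, (x i)′ = aeval z (X (Sum.inr i) : MvPolynomial (Fin n ⊕ Fin n) K) := fun i => by
    rw [aeval_X]; rfl
  refine ⟨g, fun k => ?_, ?_, ?_, ?_, ?_⟩
  · rw [← aeval_C (σ := Fin n ⊕ Fin n) z k, hg, aeval_C]
    rfl
  · rintro _ ⟨i, rfl⟩ _ ⟨j, rfl⟩
    rw [hx, hx, ← map_add, hg, hg, hg, map_add]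
  · rintro _ ⟨i, rfl⟩ _ ⟨j, rfl⟩
    rw [hx, hx, ← map_mul, hg, hg, hg, map_mul]
  · rintro _ ⟨i, rfl⟩
    rw [hx, ← map_neg, hg, hg, map_neg]
  · rintro _ ⟨i, rfl⟩
    rw [hx', hx, hg, hg, aeval_X, aeval_X]
    rfl

open Language in
-- `S` collects the values of the proper subterms. Nested derivatives pass through elements of `S`
-- one at a time, so relations of order one suffice.
lemma exists_finite_realize_term {α : Type*} (t : diffRingLanguage.Term α) (v : α → F) :
    ∃ S : Set F, S.Finite ∧ ∀ g : F → K, IsSpecializationOn S g →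
      g (t.realize v) = t.realize (g ∘ v) := by
  induction t with
  | var i => exact ⟨∅, Set.finite_empty, fun g _ => rfl⟩
  | func f ts ih =>
    choose S hS h using ih
    refine ⟨(⋃ i, S i) ∪ Set.range fun i => (ts i).realize v,
      (Set.finite_iUnion hS).union (Set.finite_range _), fun g hg => ?_⟩
    have hi : ∀ i, g ((ts i).realize v) = (ts i).realize (g ∘ v) := fun i =>
      h i g (hg.mono ((Set.subset_iUnion S i).trans Set.subset_union_left))
    have hm : ∀ i, (ts i).realize v ∈ (⋃ i, S i) ∪ Set.range fun i => (ts i).realize v :=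
      fun i => Or.inr ⟨i, rfl⟩
    rw [Term.realize_func, Term.realize_func]
    simp only [← hi]
    cases f with
    | zero => exact (congrArg g (map_zero (algebraMap K F))).symm.trans (hg.algebraMap 0)
    | one => exact (congrArg g (map_one (algebraMap K F))).symm.trans (hg.algebraMap 1)
    | neg => exact hg.neg _ (hm 0)
    | add => exact hg.add _ (hm 0) _ (hm 1)
    | mul => exact hg.mul _ (hm 0) _ (hm 1)
    | deriv => exact hg.deriv _ (hm 0)

open Language in
-- Equations specialize; inequations also do so once the inverse of the difference is put in `S`
-- (Rabinowitsch's trick), so truth values survive implications.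
lemma exists_finite_realize_iff {α : Type*} {m : ℕ} {φ : diffRingLanguage.BoundedFormula α m}
    (hφ : φ.IsQF) (v : α → F) (xs : Fin m → F) :
    ∃ S : Set F, S.Finite ∧ ∀ g : F → K, IsSpecializationOn S g →
      (φ.Realize v xs ↔ φ.Realize (g ∘ v) (g ∘ xs)) := by
  induction hφ with
  | falsum => exact ⟨∅, Set.finite_empty, fun g _ => Iff.rfl⟩
  | of_isAtomic h =>
    cases h with
    | equal t₁ t₂ =>
      obtain ⟨S₁, hS₁, h₁⟩ := exists_finite_realize_term (K := K) t₁ (Sum.elim v xs)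
      obtain ⟨S₂, hS₂, h₂⟩ := exists_finite_realize_term (K := K) t₂ (Sum.elim v xs)
      set p := t₁.realize (Sum.elim v xs)
      set q := t₂.realize (Sum.elim v xs)
      -- If `p ≠ q` but `g p = g q`, applying `g` to `(p + -q) * (p + -q)⁻¹ = 1` gives `0 = 1`. The
      -- set contains every operand of this computation.
      refine ⟨S₁ ∪ S₂ ∪ {p, q, -q, p + -q, (p + -q)⁻¹}, (hS₁.union hS₂).union (Set.toFinite _),
        fun g hg => ?_⟩
      have e₁ := h₁ g (hg.mono fun u hu => Or.inl (Or.inl hu))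
      have e₂ := h₂ g (hg.mono fun u hu => Or.inl (Or.inr hu))
      rw [Sum.comp_elim] at e₁ e₂
      rw [BoundedFormula.realize_bdEqual, BoundedFormula.realize_bdEqual, ← e₁, ← e₂]
      refine ⟨congrArg g, fun h => ?_⟩
      by_contra hne
      have h0 : p + -q ≠ 0 := by rwa [← sub_eq_add_neg, sub_ne_zero]
      have h1 := hg.mul (p + -q) (by simp) (p + -q)⁻¹ (by simp)
      rw [mul_inv_cancel₀ h0, hg.add p (by simp) (-q) (by simp), hg.neg q (by simp), h,
        add_neg_cancel, zero_mul, ← map_one (algebraMap K F), hg.algebraMap] at h1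
      exact one_ne_zero h1
    | rel R _ => exact R.elim
  | imp _ _ ih₁ ih₂ =>
    obtain ⟨S₁, hS₁, h₁⟩ := ih₁
    obtain ⟨S₂, hS₂, h₂⟩ := ih₂
    refine ⟨S₁ ∪ S₂, hS₁.union hS₂, fun g hg => ?_⟩
    rw [BoundedFormula.realize_imp, BoundedFormula.realize_imp,
      h₁ g (hg.mono Set.subset_union_left), h₂ g (hg.mono Set.subset_union_right)]

theorem PiercePillay.isDifferentiallyClosed {K : Type u} [Field K] [Differential K]
    [IsAlgClosed K] (hK : PiercePillay K) : IsDifferentiallyClosed K := by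
  rintro F _ _ _ _ t ρ hρ ⟨c, hc⟩
  obtain ⟨S, hS, h⟩ := exists_finite_realize_iff (K := K) hρ
    (Sum.elim (algebraMap K F) c) default
  obtain ⟨g, hg⟩ := hK.exists_isSpecializationOn hS
  refine ⟨g ∘ c, ?_⟩
  have h' := (h g hg).1 hc
  rw [Sum.comp_elim, show g ∘ algebraMap K F = fun k => k from funext hg.algebraMap,
    Subsingleton.elim (g ∘ default) default] at h'
  exact h'

end Backward

end DiffClosed

theorem mainTheorem2 {K : Type*} [Field K] [CharZero K] [Differential K] :
    DiffClosed.IsDifferentiallyClosed K ↔ IsAlgClosed K ∧ DiffClosed.PiercePillay K :=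
  ⟨fun h => ⟨h.isAlgClosed, h.piercePillay⟩, fun ⟨_, h⟩ => h.isDifferentiallyClosed⟩
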